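/- Let $r>1$ and let $D_r=\{(x,y)\in\mathbb{R}^2 : x^2+(y-\tfrac{r+1}{2})^2<\tfrac{(r-1)^2}{4}\}$. For a function $f\in C_0^\infty(D_r)$ (complex-valued, extended by zero to $\mathbb{R}^2$) let $\tilde f:\mathbb{R}^2\to\mathbb{C}$ be defined by $\tilde f(x)=\frac{1}{|x|^4}\,f\!\left(\frac{x}{|x|^2}\right)$ for $x\neq 0$ and $\tilde f(0)=0$. For an integrable function $g$ on $\mathbb{R}^2$ put $\hat g(\xi)=(2\pi)^{-1}\int_{\mathbb{R}^2}g(x)e^{-ix\cdot\xi}\,\mathrm{d}x$; for $\alpha\in\mathbb{R}$, such a $g$ lies in $H^\alpha=H^\alpha(\mathbb{R}^2)$ if $(1+|\xi|^2)^{\alpha/2}\hat g(\xi)\in L^2(\mathbb{R}^2)$, and then $$\|g\|_{H^\alpha}^2=\int_{\mathbb{R}^2}(1+|\xi|^2)^{\alpha}|\hat g(\xi)|^2\,\mathrm{d}\xi .$$ **Lemma.** Fix $r>1$. For every $0<\alpha<1$ there exist constants $c(\alpha)>0$ and $C(\alpha)>0$ (depending only on $\alpha$ and the fixed $r$) such that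 for every $f\in C_0^\infty(D_r)$ both $f$ and $\tilde f$ are integrable and lie in $H^\alpha$, and $$c(\alpha)\,\|\tilde f\|_{H^\alpha}\le\|f\|_{H^\alpha}\le C(\alpha)\,\|\tilde f\|_{H^\alpha}.$$ -/

import Mathlib

open scoped ContDiff

namespace DiscTransform

/-- The Fourier transform `f̂(ξ) = (2π)^(-n/2) ∫ f(x) e^(-i x·ξ) dx` on `ℝⁿ`
(for integrable `f`). -/
noncomputable def fourierT {n : ℕ} (f : EuclideanSpace ℝ (Fin n) → ℂ)
    (ξ : EuclideanSpace ℝ (Fin n)) : ℂ :=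
  (((2 * Real.pi) ^ (-(n : ℝ) / 2) : ℝ) : ℂ) *
    ∫ x, f x * Complex.exp (-Complex.I * ((inner ℝ x ξ : ℝ) : ℂ))

/-- Membership in `H^α(ℝⁿ)` for an integrable function: `(1 + |ξ|²)^(α/2) f̂(ξ)` is in `L²(ℝⁿ)`.
Integrability is part of the predicate because `f̂` is given by the Fourier integral. -/
def MemH {n : ℕ} (α : ℝ) (f : EuclideanSpace ℝ (Fin n) → ℂ) : Prop :=
  MeasureTheory.Integrable f ∧
    MeasureTheory.MemLp
      (fun ξ : EuclideanSpace ℝ (Fin n) =>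
        (((1 + ‖ξ‖ ^ 2) ^ (α / 2) : ℝ) : ℂ) * fourierT f ξ) 2

/-- The norm of `H^α(ℝⁿ)`: `‖f‖² = ∫ (1 + |ξ|²)^α |f̂(ξ)|² dξ`. -/
noncomputable def normH {n : ℕ} (α : ℝ) (f : EuclideanSpace ℝ (Fin n) → ℂ) : ℝ :=
  Real.sqrt (∫ ξ : EuclideanSpace ℝ (Fin n), (1 + ‖ξ‖ ^ 2) ^ α * ‖fourierT f ξ‖ ^ 2)

/-- The open disc `D_r` with centre `(0, (r+1)/2)` and radius `(r-1)/2`. -/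
def detectorDisc (r : ℝ) : Set (EuclideanSpace ℝ (Fin 2)) :=
  {x | x 0 ^ 2 + (x 1 - (r + 1) / 2) ^ 2 < (r - 1) ^ 2 / 4}

/-- `f ∈ C₀^∞(Ω)`, for a function given on the whole space (extended by zero outside `Ω`). -/
def IsTestFunction {n : ℕ} (Ω : Set (EuclideanSpace ℝ (Fin n)))
    (f : EuclideanSpace ℝ (Fin n) → ℂ) : Prop :=
  ContDiff ℝ ∞ f ∧ HasCompactSupport f ∧ tsupport f ⊆ Ω

/-- The inversion-weighted function `f̃(x) = |x|⁻⁴ f(x / |x|²)`, with the value `0` at `x = 0`. -/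
noncomputable def inversionWeighted (f : EuclideanSpace ℝ (Fin 2) → ℂ)
    (x : EuclideanSpace ℝ (Fin 2)) : ℂ :=
  ((1 / ‖x‖ ^ 4 : ℝ) : ℂ) * f ((1 / ‖x‖ ^ 2 : ℝ) • x)

end DiscTransform

/-!
The map `f ↦ f̃` is an involution, and `detectorDisc r` lies in the annulus `1 ≤ |x| ≤ r`. So it is
enough to bound `‖f̃‖` by a multiple of `‖f‖` for smooth `f` supported in an arbitrary fixed annulus
`a ≤ |x| ≤ b`; the inequality for `f̃`, supported in `1/b ≤ |x| ≤ 1/a`, then gives the converse.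

For `0 < α < 1` the `H^α` norm is traded for the Gagliardo (Sobolev–Slobodeckij) norm. Plancherel's
theorem turns `∫_S |h|^(-(2+2α)) ∫ |f(x+h) - f(x)|² dx dh` into `∫ K_S(ξ) |f̂(ξ)|² dξ` with
`K_S(ξ) = ∫_S |h|^(-(2+2α)) |e^(i h·ξ) - 1|² dh` (`gagliardoEnergy_eq_lintegral_symbol`). The symbol
satisfies `K_S(ξ) ≤ C (1 + |ξ|²)^α` for the whole plane (`exists_gagliardoSymbol_le`) and
`(1 + |ξ|²)^α ≤ C (1 + K_S(ξ))` for an arbitrarily small disc `S` around the origin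
(`exists_le_one_add_gagliardoSymbol`). Hence `‖f̃‖²` may be measured with short steps only, and
`‖f‖²` with all of them.

With steps shorter than half the inner radius of the support of `f̃`, all points that occur lie in an
annulus away from the origin. There the inversion has bounded Jacobian, and
`|x - y| = |x| |y| |x/|x|² - y/|y|²|` compares the kernels. The only new term,
from the variation of the smooth weight `|x|⁻⁴`, is at most a multiple of
`|u - v|^(2-(2+2α)) |f(u)|²` with `u` and `v` the inverted points, and its kernel is locally
integrable because `α < 1`; so it is absorbed by the `L²` norm
(`exists_gagliardoEnergy_inversionWeighted_le`).
-/

open scoped ContDiff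

namespace DiscTransform

open MeasureTheory ENNReal EuclideanGeometry
open scoped FourierTransform SchwartzMap

/-! ### Plancherel's theorem and difference quotients -/

theorem fourierT_eq_fourier {n : ℕ} (f : EuclideanSpace ℝ (Fin n) → ℂ)
    (ξ : EuclideanSpace ℝ (Fin n)) :
    fourierT f ξ =
      (((2 * Real.pi) ^ (-(n : ℝ) / 2) : ℝ) : ℂ) * 𝓕 f ((2 * Real.pi)⁻¹ • ξ) := by
  unfold fourierT
  rw [Real.fourier_eq']
  congr 1
  refine integral_congr_ae (Filter.Eventually.of_forall fun x => ?_)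
  have hpi : (2 * Real.pi) ≠ 0 := by positivity
  simp only [smul_eq_mul]
  rw [mul_comm]
  congr 2
  rw [inner_smul_right]
  have : -2 * Real.pi * ((2 * Real.pi)⁻¹ * inner ℝ x ξ) = - inner ℝ x ξ := by
    field_simp
  rw [this]
  push_cast
  ring

theorem lintegral_comp_smul {n : ℕ} (g : EuclideanSpace ℝ (Fin n) → ℝ≥0∞) {R : ℝ} (hR : 0 < R) :
    ∫⁻ x, g (R • x) = ENNReal.ofReal ((R ^ n)⁻¹) * ∫⁻ x, g x := by
  have h := (Homeomorph.smulOfNeZero R hR.ne' :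
    EuclideanSpace ℝ (Fin n) ≃ₜ EuclideanSpace ℝ (Fin n)).measurableEmbedding
  have h2 := h.lintegral_map (μ := volume) g
  simp only [Homeomorph.smulOfNeZero_apply] at h2
  rw [← h2]
  rw [Measure.map_addHaar_smul volume hR.ne', lintegral_smul_measure]
  simp [abs_of_pos hR]

theorem lintegral_enorm_sq_fourier {n : ℕ} (f : 𝓢(EuclideanSpace ℝ (Fin n), ℂ)) :
    ∫⁻ ξ, ‖𝓕 f ξ‖ₑ ^ 2 = ∫⁻ x, ‖f x‖ₑ ^ 2 := by
  have key (g : 𝓢(EuclideanSpace ℝ (Fin n), ℂ)) :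
      ∫⁻ x, ‖g x‖ₑ ^ 2 = ENNReal.ofReal (∫ x, ‖g x‖ ^ 2) := by
    have hi : Integrable fun x => ‖g x‖ ^ 2 := (g.memLp 2).integrable_norm_pow (by simp)
    rw [ofReal_integral_eq_lintegral_ofReal hi
      (Filter.Eventually.of_forall fun _ => by positivity)]
    refine lintegral_congr fun x => ?_
    rw [ENNReal.ofReal_pow (norm_nonneg _), ofReal_norm]
  rw [key, key, SchwartzMap.integral_norm_sq_fourier]

theorem lintegral_enorm_sq_fourierT {n : ℕ} (f : 𝓢(EuclideanSpace ℝ (Fin n), ℂ)) :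
    ∫⁻ ξ, ‖fourierT f ξ‖ₑ ^ 2 = ∫⁻ x, ‖f x‖ₑ ^ 2 := by
  have hpi : 0 < 2 * Real.pi := by positivity
  simp_rw [fourierT_eq_fourier, enorm_mul, mul_pow]
  rw [lintegral_const_mul' _ _ (by finiteness),
    lintegral_comp_smul (fun ξ => ‖𝓕 (f : EuclideanSpace ℝ (Fin n) → ℂ) ξ‖ₑ ^ 2)
      (inv_pos.mpr hpi), ← mul_assoc, ← SchwartzMap.fourier_coe, lintegral_enorm_sq_fourier]
  -- the normalising factor `(2π)^(-n)` cancels the Jacobian of the dilation by `2π`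
  have : ‖(((2 * Real.pi) ^ (-(n : ℝ) / 2) : ℝ) : ℂ)‖ₑ ^ 2 *
      ENNReal.ofReal ((((2 * Real.pi)⁻¹) ^ n)⁻¹) = 1 := by
    rw [← ofReal_norm, ← ENNReal.ofReal_pow (norm_nonneg _), ← ENNReal.ofReal_mul (by positivity),
      Complex.norm_real, Real.norm_of_nonneg (by positivity), ← Real.rpow_mul_natCast hpi.le]
    have h2 : -(n : ℝ) / 2 * (2 : ℕ) = -(n : ℝ) := by push_cast; ring
    rw [h2, Real.rpow_neg hpi.le, Real.rpow_natCast, inv_pow, inv_inv, inv_mul_cancel₀ (by positivity),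
      ENNReal.ofReal_one]
  rw [this, one_mul]

theorem fourierT_comp_add_right {n : ℕ} (f : EuclideanSpace ℝ (Fin n) → ℂ)
    (h ξ : EuclideanSpace ℝ (Fin n)) :
    fourierT (fun x => f (x + h)) ξ =
      Complex.exp (Complex.I * ((inner ℝ h ξ : ℝ) : ℂ)) * fourierT f ξ := by
  unfold fourierT
  rw [mul_left_comm]
  congr 1
  rw [← integral_const_mul]
  -- translate the integration variable by `h` on the right-hand side
  rw [← integral_add_right_eq_self
    (fun x => Complex.exp (Complex.I * ((inner ℝ h ξ : ℝ) : ℂ)) *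
      (f x * Complex.exp (-Complex.I * ((inner ℝ x ξ : ℝ) : ℂ)))) h]
  refine integral_congr_ae (Filter.Eventually.of_forall fun x => ?_)
  simp only
  rw [mul_left_comm, ← Complex.exp_add, inner_add_left]
  congr 2
  push_cast
  ring

theorem fourierT_sub {n : ℕ} {f g : EuclideanSpace ℝ (Fin n) → ℂ} (hf : Integrable f)
    (hg : Integrable g) (ξ : EuclideanSpace ℝ (Fin n)) :
    fourierT (fun x => f x - g x) ξ = fourierT f ξ - fourierT g ξ := by
  have key {f : EuclideanSpace ℝ (Fin n) → ℂ} (hf : Integrable f) :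
      Integrable fun x => f x * Complex.exp (-Complex.I * ((inner ℝ x ξ : ℝ) : ℂ)) := by
    refine hf.mul_bdd (c := 1) (by fun_prop) (Filter.Eventually.of_forall fun x => ?_)
    rw [neg_mul, ← mul_neg, mul_comm, ← Complex.ofReal_neg, Complex.norm_exp_ofReal_mul_I]
  unfold fourierT
  simp_rw [sub_mul]
  rw [integral_sub (key hf) (key hg), mul_sub]

theorem lintegral_enorm_sq_sub_translate {n : ℕ} (f : 𝓢(EuclideanSpace ℝ (Fin n), ℂ))
    (h : EuclideanSpace ℝ (Fin n)) :
    ∫⁻ x, ‖f (x + h) - f x‖ₑ ^ 2 =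
      ∫⁻ ξ, ‖Complex.exp (Complex.I * ((inner ℝ h ξ : ℝ) : ℂ)) - 1‖ₑ ^ 2 *
        ‖fourierT f ξ‖ₑ ^ 2 := by
  let g : 𝓢(EuclideanSpace ℝ (Fin n), ℂ) := f.compSubConstCLM ℂ (-h) - f
  have hg : (g : EuclideanSpace ℝ (Fin n) → ℂ) = fun x => f (x + h) - f x := by
    ext x
    simp [g]
  have h1 := lintegral_enorm_sq_fourierT g
  rw [hg] at h1
  rw [← h1]
  refine lintegral_congr fun ξ => ?_
  rw [fourierT_sub (f.integrable.comp_add_right h) f.integrable, fourierT_comp_add_right,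
    ← mul_pow, ← enorm_mul, sub_mul, one_mul]

/-- The kernel `|h|^(-(n+2α))` of the Gagliardo seminorm of order `α` on `ℝⁿ`; at `h = 0` the
value is `0`. -/
noncomputable def gagliardoKernel (n : ℕ) (α : ℝ) (h : EuclideanSpace ℝ (Fin n)) : ℝ≥0∞ :=
  ENNReal.ofReal (‖h‖ ^ (-((n : ℝ) + 2 * α)))

@[fun_prop]
theorem measurable_gagliardoKernel (n : ℕ) (α : ℝ) : Measurable (gagliardoKernel n α) := by
  unfold gagliardoKernel
  fun_prop

/-- The squared Gagliardo seminorm of order `α`, with the differences restricted to steps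
`h ∈ S`. -/
noncomputable def gagliardoEnergy {n : ℕ} (α : ℝ) (S : Set (EuclideanSpace ℝ (Fin n)))
    (f : EuclideanSpace ℝ (Fin n) → ℂ) : ℝ≥0∞ :=
  ∫⁻ h in S, gagliardoKernel n α h * ∫⁻ x, ‖f (x + h) - f x‖ₑ ^ 2

/-- The Fourier symbol of `gagliardoEnergy`. -/
noncomputable def gagliardoSymbol {n : ℕ} (α : ℝ) (S : Set (EuclideanSpace ℝ (Fin n)))
    (ξ : EuclideanSpace ℝ (Fin n)) : ℝ≥0∞ :=
  ∫⁻ h in S, gagliardoKernel n α h *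
    ‖Complex.exp (Complex.I * ((inner ℝ h ξ : ℝ) : ℂ)) - 1‖ₑ ^ 2

theorem continuous_fourierT {n : ℕ} (f : 𝓢(EuclideanSpace ℝ (Fin n), ℂ)) :
    Continuous (fourierT f) := by
  have : fourierT f = fun ξ => (((2 * Real.pi) ^ (-(n : ℝ) / 2) : ℝ) : ℂ) *
      (𝓕 f) ((2 * Real.pi)⁻¹ • ξ) := by
    ext ξ
    rw [fourierT_eq_fourier, SchwartzMap.fourier_coe]
  rw [this]
  have := (𝓕 f).continuous
  fun_prop

theorem gagliardoEnergy_eq_lintegral_symbol {n : ℕ} (α : ℝ)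
    (S : Set (EuclideanSpace ℝ (Fin n))) (f : 𝓢(EuclideanSpace ℝ (Fin n), ℂ)) :
    gagliardoEnergy α S f = ∫⁻ ξ, gagliardoSymbol α S ξ * ‖fourierT f ξ‖ₑ ^ 2 := by
  have hc := continuous_fourierT f
  unfold gagliardoEnergy gagliardoSymbol
  simp_rw [lintegral_enorm_sq_sub_translate]
  have h1 : ∀ h : EuclideanSpace ℝ (Fin n), gagliardoKernel n α h * ∫⁻ ξ,
      ‖Complex.exp (Complex.I * ((inner ℝ h ξ : ℝ) : ℂ)) - 1‖ₑ ^ 2 * ‖fourierT f ξ‖ₑ ^ 2 =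
      ∫⁻ ξ, gagliardoKernel n α h *
      ‖Complex.exp (Complex.I * ((inner ℝ h ξ : ℝ) : ℂ)) - 1‖ₑ ^ 2 * ‖fourierT f ξ‖ₑ ^ 2 := by
    intro h
    rw [← lintegral_const_mul _ (by fun_prop)]
    simp_rw [mul_assoc]
  simp_rw [h1]
  rw [lintegral_lintegral_swap (by fun_prop)]
  refine lintegral_congr fun ξ => ?_
  rw [lintegral_mul_const _ (by fun_prop)]

/-! ### The Sobolev norm as a lower integral -/

/-- The squared `H^α` norm, as an extended nonnegative number. -/
noncomputable def sobolevEnergy {n : ℕ} (α : ℝ) (f : EuclideanSpace ℝ (Fin n) → ℂ) : ℝ≥0∞ :=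
  ∫⁻ ξ, ENNReal.ofReal ((1 + ‖ξ‖ ^ 2) ^ α) * ‖fourierT f ξ‖ₑ ^ 2

theorem memH_of_schwartz {n : ℕ} (α : ℝ) (f : 𝓢(EuclideanSpace ℝ (Fin n), ℂ)) :
    MemH α f := by
  refine ⟨f.integrable, ?_⟩
  have hpi : (2 * Real.pi)⁻¹ ≠ 0 := by positivity
  let L : EuclideanSpace ℝ (Fin n) ≃L[ℝ] EuclideanSpace ℝ (Fin n) :=
    ContinuousLinearEquiv.smulLeft (Units.mk0 _ hpi)
  let g : 𝓢(EuclideanSpace ℝ (Fin n), ℂ) := SchwartzMap.smulLeftCLM ℂ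
    (fun ξ : EuclideanSpace ℝ (Fin n) => ((1 + ‖ξ‖ ^ 2) ^ (α / 2) : ℝ))
    (SchwartzMap.compCLMOfContinuousLinearEquiv ℝ L (𝓕 f))
  have hg : (fun ξ : EuclideanSpace ℝ (Fin n) =>
        (((1 + ‖ξ‖ ^ 2) ^ (α / 2) : ℝ) : ℂ) * fourierT f ξ) =
      fun ξ => (((2 * Real.pi) ^ (-(n : ℝ) / 2) : ℝ) : ℂ) * g ξ := by
    ext ξ
    rw [SchwartzMap.smulLeftCLM_apply_apply (by fun_prop), fourierT_eq_fourier,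
      ← SchwartzMap.fourier_coe]
    have hL : L ξ = (2 * Real.pi)⁻¹ • ξ := rfl
    simp only [SchwartzMap.compCLMOfContinuousLinearEquiv_apply, Function.comp_apply, hL,
      Complex.real_smul]
    ring
  rw [hg]
  exact (g.memLp 2).const_mul _

theorem sobolevEnergy_ne_top {n : ℕ} (α : ℝ) (f : 𝓢(EuclideanSpace ℝ (Fin n), ℂ)) :
    sobolevEnergy α f ≠ ⊤ := by
  have h := (memH_of_schwartz α f).2
  have h2 := h.eLpNorm_lt_top
  rw [eLpNorm_lt_top_iff_lintegral_rpow_enorm_lt_top (by simp) (by simp)] at h2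
  refine ne_of_lt (lt_of_eq_of_lt ?_ h2)
  refine lintegral_congr fun ξ => ?_
  simp only [toReal_ofNat, ENNReal.rpow_ofNat, enorm_mul, mul_pow]
  congr 1
  have h0 : (0 : ℝ) ≤ 1 + ‖ξ‖ ^ 2 := by positivity
  rw [← ofReal_norm, ← ENNReal.ofReal_pow (norm_nonneg _), Complex.norm_real,
    Real.norm_of_nonneg (by positivity), ← Real.rpow_mul_natCast h0]
  congr 2
  push_cast; ring

theorem normH_eq_sqrt_sobolevEnergy {n : ℕ} (α : ℝ) (f : 𝓢(EuclideanSpace ℝ (Fin n), ℂ)) :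
    normH α f = Real.sqrt (sobolevEnergy α f).toReal := by
  have hc := continuous_fourierT f
  unfold normH sobolevEnergy
  rw [integral_eq_lintegral_of_nonneg_ae (Filter.Eventually.of_forall fun _ => by positivity)]
  · congr 2
    refine lintegral_congr fun ξ => ?_
    rw [ENNReal.ofReal_mul (by positivity), ENNReal.ofReal_pow (norm_nonneg _), ofReal_norm]
  · have : Measurable fun ξ : EuclideanSpace ℝ (Fin n) => (1 + ‖ξ‖ ^ 2) ^ α * ‖fourierT f ξ‖ ^ 2 := by
      fun_prop
    exact this.aestronglyMeasurable

/-! ### Two-sided bounds for the symbol of the Gagliardo seminorm on the plane -/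

theorem setLIntegral_ball_norm_sq_mul_gagliardoKernel_lt_top {α : ℝ} (hα : α < 1) (R : ℝ) :
    ∫⁻ h in Metric.ball (0 : EuclideanSpace ℝ (Fin 2)) R,
      ENNReal.ofReal (‖h‖ ^ 2) * gagliardoKernel 2 α h < ⊤ := by
  have key : IntegrableOn (fun h : EuclideanSpace ℝ (Fin 2) =>
      ‖h‖ ^ 2 * ‖h‖ ^ (-(((2 : ℕ) : ℝ) + 2 * α))) (Metric.ball 0 R) := by
    refine (integrableOn_fun_norm_addHaar volume
      (f := fun y : ℝ => y ^ 2 * y ^ (-(((2 : ℕ) : ℝ) + 2 * α)))).mpr ?_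
    rcases le_or_gt R 0 with hR | hR
    · simp [Set.Ioo_eq_empty (not_lt.mpr hR)]
    have := (intervalIntegral.integrableOn_Ioo_rpow_iff (s := 1 - 2 * α) hR).mpr (by linarith)
    refine this.congr_fun (fun y hy => ?_) measurableSet_Ioo
    have hy0 : 0 < y := hy.1
    simp only [finrank_euclideanSpace, Fintype.card_fin, smul_eq_mul]
    rw [← Real.rpow_natCast, ← Real.rpow_natCast y 2, ← Real.rpow_add hy0, ← Real.rpow_add hy0]
    congr 1
    push_cast
    ring
  refine lt_of_eq_of_lt ?_ key.lintegral_lt_top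
  refine lintegral_congr fun h => ?_
  rw [gagliardoKernel, ENNReal.ofReal_mul (by positivity)]

theorem setLIntegral_gagliardoKernel_lt_top {α : ℝ} (hα : 0 < α) :
    ∫⁻ h in {h : EuclideanSpace ℝ (Fin 2) | 1 < ‖h‖}, gagliardoKernel 2 α h < ⊤ := by
  have hs : MeasurableSet {h : EuclideanSpace ℝ (Fin 2) | 1 < ‖h‖} :=
    measurableSet_lt measurable_const measurable_norm
  have key : IntegrableOn (fun h : EuclideanSpace ℝ (Fin 2) =>
      ‖h‖ ^ (-(((2 : ℕ) : ℝ) + 2 * α))) {h | 1 < ‖h‖} := by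
    rw [← integrable_indicator_iff hs]
    have := (integrable_fun_norm_addHaar (volume : Measure (EuclideanSpace ℝ (Fin 2)))
      (f := (Set.Ioi (1 : ℝ)).indicator fun y : ℝ => y ^ (-(((2 : ℕ) : ℝ) + 2 * α)))).mpr ?_
    · exact this
    have h1 : IntegrableOn (fun y : ℝ => y ^ (-1 - 2 * α)) (Set.Ioi 1) :=
      integrableOn_Ioi_rpow_of_lt (by linarith) one_pos
    have h2 := (h1.integrable_indicator measurableSet_Ioi).integrableOn (s := Set.Ioi 0)
    refine h2.congr_fun (fun y hy => ?_) measurableSet_Ioi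
    have hy0 : 0 < y := hy
    by_cases hy1 : 1 < y
    · simp only [finrank_euclideanSpace, Fintype.card_fin, smul_eq_mul, Set.indicator, Set.mem_Ioi,
        hy1, if_true]
      rw [← Real.rpow_natCast, ← Real.rpow_add hy0]
      congr 1
      push_cast
      ring
    · simp [hy1]
  exact key.lintegral_lt_top

theorem lintegral_min_mul_gagliardoKernel_lt_top {α : ℝ} (hα₀ : 0 < α) (hα₁ : α < 1) :
    ∫⁻ h : EuclideanSpace ℝ (Fin 2),
      ENNReal.ofReal (min 4 (‖h‖ ^ 2)) * gagliardoKernel 2 α h < ⊤ := by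
  have hu : (Set.univ : Set (EuclideanSpace ℝ (Fin 2))) =
      Metric.ball 0 2 ∪ {h | 1 < ‖h‖} := by
    ext h
    simp only [Set.mem_univ, Set.mem_union, mem_ball_zero_iff, Set.mem_ofPred_eq, true_iff]
    rcases lt_or_ge ‖h‖ 2 with h | h
    · exact Or.inl h
    · exact Or.inr (by linarith)
  rw [← setLIntegral_univ, hu]
  refine (lintegral_union_le _ _ _).trans_lt (ENNReal.add_lt_top.mpr ⟨?_, ?_⟩)
  · refine lt_of_le_of_lt (lintegral_mono fun h => ?_)
      (setLIntegral_ball_norm_sq_mul_gagliardoKernel_lt_top hα₁ 2)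
    gcongr
    exact min_le_right _ _
  · refine lt_of_le_of_lt (b := ∫⁻ h in {h : EuclideanSpace ℝ (Fin 2) | 1 < ‖h‖},
      ENNReal.ofReal 4 * gagliardoKernel 2 α h) (lintegral_mono fun h => ?_) ?_
    · gcongr
      exact min_le_left _ _
    · rw [lintegral_const_mul _ (by fun_prop)]
      exact ENNReal.mul_lt_top (by finiteness) (setLIntegral_gagliardoKernel_lt_top hα₀)

theorem gagliardoKernel_smul {n : ℕ} (α : ℝ) {ρ : ℝ} (hρ : 0 < ρ)
    (h : EuclideanSpace ℝ (Fin n)) :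
    gagliardoKernel n α h =
      ENNReal.ofReal (ρ ^ ((n : ℝ) + 2 * α)) * gagliardoKernel n α (ρ • h) := by
  unfold gagliardoKernel
  rw [← ENNReal.ofReal_mul (by positivity), norm_smul, Real.norm_of_nonneg hρ.le,
    Real.mul_rpow hρ.le (norm_nonneg _), ← mul_assoc, ← Real.rpow_add hρ]
  simp

/-- The dilation `h = k / ρ` with `ρ² = 1 + |ξ|²` turns the integral into a multiple of one that
does not depend on `ξ`. -/
theorem exists_gagliardoSymbol_le {α : ℝ} (hα₀ : 0 < α) (hα₁ : α < 1) :
    ∃ C : ℝ≥0∞, C ≠ ⊤ ∧ ∀ ξ : EuclideanSpace ℝ (Fin 2),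
      gagliardoSymbol α Set.univ ξ ≤ C * ENNReal.ofReal ((1 + ‖ξ‖ ^ 2) ^ α) := by
  refine ⟨_, (lintegral_min_mul_gagliardoKernel_lt_top hα₀ hα₁).ne, fun ξ => ?_⟩
  set φ : EuclideanSpace ℝ (Fin 2) → ℝ≥0∞ :=
    fun h => ENNReal.ofReal (min 4 (‖h‖ ^ 2)) * gagliardoKernel 2 α h with hφ
  set ρ : ℝ := √(1 + ‖ξ‖ ^ 2) with hρ
  have hρ0 : 0 < ρ := by positivity
  have hρ2 : ρ ^ 2 = 1 + ‖ξ‖ ^ 2 := Real.sq_sqrt (by positivity)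
  have hpt (h : EuclideanSpace ℝ (Fin 2)) : gagliardoKernel 2 α h *
      ‖Complex.exp (Complex.I * ((inner ℝ h ξ : ℝ) : ℂ)) - 1‖ₑ ^ 2 ≤
      ENNReal.ofReal (ρ ^ (((2 : ℕ) : ℝ) + 2 * α)) * φ (ρ • h) := by
    rw [gagliardoKernel_smul α hρ0 h, hφ, mul_assoc]
    refine mul_le_mul_right ?_ _
    rw [mul_comm]
    refine mul_le_mul_left ?_ _
    rw [← ofReal_norm, ← ENNReal.ofReal_pow (norm_nonneg _)]
    refine ENNReal.ofReal_le_ofReal (le_min ?_ ?_)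
    · have : ‖Complex.exp (Complex.I * ((inner ℝ h ξ : ℝ) : ℂ)) - 1‖ ≤ 2 := by
        refine (norm_sub_le _ _).trans ?_
        rw [mul_comm, Complex.norm_exp_ofReal_mul_I, norm_one]
        norm_num
      nlinarith [norm_nonneg (Complex.exp (Complex.I * ((inner ℝ h ξ : ℝ) : ℂ)) - 1)]
    · refine pow_le_pow_left₀ (norm_nonneg _) ?_ 2
      refine Real.norm_exp_I_mul_ofReal_sub_one_le.trans ((norm_inner_le_norm h ξ).trans ?_)
      rw [norm_smul, Real.norm_of_nonneg hρ0.le, mul_comm]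
      refine mul_le_mul_of_nonneg_right ?_ (norm_nonneg _)
      exact Real.le_sqrt_of_sq_le (by linarith)
  calc gagliardoSymbol α Set.univ ξ
      ≤ ∫⁻ h, ENNReal.ofReal (ρ ^ (((2 : ℕ) : ℝ) + 2 * α)) * φ (ρ • h) := by
        rw [gagliardoSymbol, setLIntegral_univ]
        exact lintegral_mono hpt
    _ = ENNReal.ofReal (ρ ^ (((2 : ℕ) : ℝ) + 2 * α)) *
          (ENNReal.ofReal ((ρ ^ 2)⁻¹) * ∫⁻ h, φ h) := by
        rw [lintegral_const_mul' _ _ (by finiteness), lintegral_comp_smul φ hρ0]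
    _ = (∫⁻ h, φ h) * ENNReal.ofReal ((1 + ‖ξ‖ ^ 2) ^ α) := by
        rw [← mul_assoc, ← ENNReal.ofReal_mul (by positivity), mul_comm, ← hρ2]
        congr 2
        rw [← Real.rpow_natCast ρ 2, ← Real.rpow_neg hρ0.le, ← Real.rpow_add hρ0,
          ← Real.rpow_mul hρ0.le]
        congr 1
        push_cast
        ring

/-- The lower bound comes from the steps `h` in the disc of centre `η ξ / |ξ|²` and radius
`η / (2|ξ|)`, on which the phase `h·ξ` stays in `[η/2, 3η/2]`. -/
theorem exists_le_gagliardoSymbol_of_one_le_norm (α : ℝ) (hα₀ : 0 < α) {δ : ℝ} (hδ : 0 < δ) :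
    ∃ c : ℝ, 0 < c ∧ ∀ ξ : EuclideanSpace ℝ (Fin 2), 1 ≤ ‖ξ‖ →
      ENNReal.ofReal (c * ‖ξ‖ ^ (2 * α)) ≤ gagliardoSymbol α (Metric.ball 0 δ) ξ := by
  set V : ℝ := (volume (Metric.ball (0 : EuclideanSpace ℝ (Fin 2)) 1)).toReal with hV
  have hV0 : 0 < V := ENNReal.toReal_pos
    (Metric.measure_ball_pos _ _ one_pos).ne' measure_ball_lt_top.ne
  have hVe : volume (Metric.ball (0 : EuclideanSpace ℝ (Fin 2)) 1) = ENNReal.ofReal V :=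
    (ENNReal.ofReal_toReal measure_ball_lt_top.ne).symm
  set η : ℝ := min 1 (δ / 2) with hη
  have hη0 : 0 < η := lt_min one_pos (by linarith)
  have hη1 : η ≤ 1 := min_le_left _ _
  have hηδ : η ≤ δ / 2 := min_le_right _ _
  set s : ℝ := ((2 : ℕ) : ℝ) + 2 * α with hs
  have hs0 : 0 < s := by positivity
  refine ⟨(3 * η / 2) ^ (-s) * (η / 4) ^ 2 * (η / 2) ^ 2 * V, by positivity, fun ξ hξ => ?_⟩
  have hξ0 : 0 < ‖ξ‖ := by linarith
  set c : EuclideanSpace ℝ (Fin 2) := (η / ‖ξ‖ ^ 2) • ξ with hc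
  have hcn : ‖c‖ = η / ‖ξ‖ := by
    rw [hc, norm_smul, Real.norm_of_nonneg (by positivity)]
    field_simp
  have hci : inner ℝ c ξ = η := by
    rw [hc, real_inner_smul_left, real_inner_self_eq_norm_sq]
    field_simp
  have hB (h : EuclideanSpace ℝ (Fin 2)) (hh : h ∈ Metric.ball c (η / (2 * ‖ξ‖))) :
      ‖h‖ ≤ (3 * η / 2) / ‖ξ‖ ∧ |inner ℝ h ξ - η| ≤ η / 2 := by
    rw [mem_ball_iff_norm] at hh
    constructor
    · calc ‖h‖ = ‖(h - c) + c‖ := by simp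
        _ ≤ η / (2 * ‖ξ‖) + η / ‖ξ‖ := (norm_add_le _ _).trans (by linarith [hcn.le])
        _ = _ := by field_simp; ring
    · rw [← hci, ← inner_sub_left]
      refine (abs_real_inner_le_norm _ _).trans ?_
      rw [hci]
      calc ‖h - c‖ * ‖ξ‖ ≤ η / (2 * ‖ξ‖) * ‖ξ‖ := by gcongr
        _ = η / 2 := by field_simp
  have hsub : Metric.ball c (η / (2 * ‖ξ‖)) ⊆ Metric.ball 0 δ := by
    intro h hh
    rw [mem_ball_zero_iff]
    have h1 : (3 * η / 2) / ‖ξ‖ ≤ 3 * η / 2 := div_le_self (by positivity) hξ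
    linarith [(hB h hh).1]
  have hpt (h : EuclideanSpace ℝ (Fin 2)) (hh : h ∈ Metric.ball c (η / (2 * ‖ξ‖))) :
      ENNReal.ofReal (((3 * η / 2) / ‖ξ‖) ^ (-s) * (η / 4) ^ 2) ≤ gagliardoKernel 2 α h *
        ‖Complex.exp (Complex.I * ((inner ℝ h ξ : ℝ) : ℂ)) - 1‖ₑ ^ 2 := by
    obtain ⟨h1, h2⟩ := hB h hh
    rw [abs_le] at h2
    set t : ℝ := inner ℝ h ξ with ht
    have ht0 : η / 2 ≤ t := by linarith
    have ht1 : t ≤ 3 / 2 := by linarith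
    have hh0 : 0 < ‖h‖ := by
      rw [norm_pos_iff]
      rintro rfl
      rw [inner_zero_left] at ht
      linarith
    rw [gagliardoKernel, ← ofReal_norm, ← ENNReal.ofReal_pow (norm_nonneg _),
      ← ENNReal.ofReal_mul (by positivity)]
    refine ENNReal.ofReal_le_ofReal (mul_le_mul ?_ ?_ (by positivity) (by positivity))
    · exact Real.rpow_le_rpow_of_nonpos hh0 h1 (by linarith)
    · refine pow_le_pow_left₀ (by positivity) ?_ 2
      rw [Complex.norm_exp_I_mul_ofReal_sub_one, Real.norm_eq_abs]
      refine le_trans ?_ (le_abs_self _)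
      have hpi := Real.pi_gt_three
      have hpi4 := Real.pi_le_four
      have hsin := Real.mul_le_sin (x := t / 2) (by linarith) (by linarith)
      have h3 : (1 / 2 : ℝ) ≤ 2 / Real.pi := by
        rw [div_le_div_iff₀ (by norm_num) (by positivity)]; linarith
      nlinarith [mul_le_mul_of_nonneg_right h3 (by linarith : (0 : ℝ) ≤ t / 2)]
  calc ENNReal.ofReal ((3 * η / 2) ^ (-s) * (η / 4) ^ 2 * (η / 2) ^ 2 * V * ‖ξ‖ ^ (2 * α))
      = ENNReal.ofReal (((3 * η / 2) / ‖ξ‖) ^ (-s) * (η / 4) ^ 2) *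
          volume (Metric.ball c (η / (2 * ‖ξ‖))) := by
        rw [Measure.addHaar_ball _ _ (by positivity), hVe, ← ENNReal.ofReal_mul (by positivity),
          ← ENNReal.ofReal_mul (by positivity)]
        congr 1
        have : ‖ξ‖ ^ (2 * α) = ‖ξ‖ ^ s / ‖ξ‖ ^ 2 := by
          rw [← Real.rpow_natCast ‖ξ‖ 2, ← Real.rpow_sub hξ0, hs]
          congr 1
          ring
        rw [this, Real.div_rpow (by positivity) hξ0.le, Real.rpow_neg hξ0.le]
        simp only [finrank_euclideanSpace, Fintype.card_fin]
        field_simp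
    _ = ∫⁻ _ in Metric.ball c (η / (2 * ‖ξ‖)),
          ENNReal.ofReal (((3 * η / 2) / ‖ξ‖) ^ (-s) * (η / 4) ^ 2) := by
        rw [setLIntegral_const]
    _ ≤ ∫⁻ h in Metric.ball c (η / (2 * ‖ξ‖)), gagliardoKernel 2 α h *
          ‖Complex.exp (Complex.I * ((inner ℝ h ξ : ℝ) : ℂ)) - 1‖ₑ ^ 2 :=
        setLIntegral_mono' Metric.isOpen_ball.measurableSet hpt
    _ ≤ gagliardoSymbol α (Metric.ball 0 δ) ξ := lintegral_mono_set hsub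

/-- The constant `1` on the right takes care of the frequencies `|ξ| ≤ 1`. -/
theorem exists_le_one_add_gagliardoSymbol {α : ℝ} (hα₀ : 0 < α) {δ : ℝ} (hδ : 0 < δ) :
    ∃ C : ℝ≥0∞, C ≠ ⊤ ∧ ∀ ξ : EuclideanSpace ℝ (Fin 2),
      ENNReal.ofReal ((1 + ‖ξ‖ ^ 2) ^ α) ≤ C * (1 + gagliardoSymbol α (Metric.ball 0 δ) ξ) := by
  obtain ⟨c, hc, hK⟩ := exists_le_gagliardoSymbol_of_one_le_norm α hα₀ hδ
  refine ⟨ENNReal.ofReal (2 ^ α) + ENNReal.ofReal (2 ^ α / c), by finiteness, fun ξ => ?_⟩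
  rcases le_total ‖ξ‖ 1 with h | h
  · have h1 : ENNReal.ofReal ((1 + ‖ξ‖ ^ 2) ^ α) ≤ ENNReal.ofReal (2 ^ α) := by
      refine ENNReal.ofReal_le_ofReal (Real.rpow_le_rpow (by positivity) ?_ hα₀.le)
      nlinarith [norm_nonneg ξ]
    calc _ ≤ ENNReal.ofReal (2 ^ α) * 1 := by rwa [mul_one]
      _ ≤ _ := by gcongr <;> exact le_self_add
  · have hξ0 : 0 < ‖ξ‖ := by linarith
    have h1 : ENNReal.ofReal ((1 + ‖ξ‖ ^ 2) ^ α) ≤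
        ENNReal.ofReal (2 ^ α / c) * ENNReal.ofReal (c * ‖ξ‖ ^ (2 * α)) := by
      rw [← ENNReal.ofReal_mul (by positivity)]
      refine ENNReal.ofReal_le_ofReal ?_
      calc (1 + ‖ξ‖ ^ 2) ^ α ≤ (2 * ‖ξ‖ ^ 2) ^ α :=
            Real.rpow_le_rpow (by positivity) (by nlinarith) hα₀.le
        _ = 2 ^ α / c * (c * ‖ξ‖ ^ (2 * α)) := by
            rw [Real.mul_rpow (by norm_num) (by positivity), Real.rpow_mul hξ0.le]
            norm_num
            field_simp
    refine h1.trans ?_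
    gcongr
    · exact le_add_self
    · exact (hK ξ h).trans le_add_self

/-- Short steps already control the `H^α` norm: the symbol of the energy over a small disc grows
like `|ξ|^(2α)`. -/
theorem exists_sobolevEnergy_le {α : ℝ} (hα₀ : 0 < α) {δ : ℝ} (hδ : 0 < δ) :
    ∃ C : ℝ≥0∞, C ≠ ⊤ ∧ ∀ f : 𝓢(EuclideanSpace ℝ (Fin 2), ℂ),
      sobolevEnergy α f ≤
        C * ((∫⁻ x, ‖f x‖ₑ ^ 2) + gagliardoEnergy α (Metric.ball 0 δ) f) := by
  obtain ⟨C, hC, hK⟩ := exists_le_one_add_gagliardoSymbol hα₀ hδ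
  refine ⟨C, hC, fun f => ?_⟩
  have hc := continuous_fourierT f
  rw [gagliardoEnergy_eq_lintegral_symbol, ← lintegral_enorm_sq_fourierT,
    ← lintegral_add_left (by fun_prop), ← lintegral_const_mul' _ _ hC]
  refine lintegral_mono fun ξ => ?_
  calc _ ≤ C * (1 + gagliardoSymbol α (Metric.ball 0 δ) ξ) * ‖fourierT f ξ‖ₑ ^ 2 := by
        gcongr
        exact hK ξ
    _ = _ := by ring

theorem exists_le_sobolevEnergy {α : ℝ} (hα₀ : 0 < α) (hα₁ : α < 1) :
    ∃ C : ℝ≥0∞, C ≠ ⊤ ∧ ∀ f : 𝓢(EuclideanSpace ℝ (Fin 2), ℂ),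
      (∫⁻ x, ‖f x‖ₑ ^ 2) + gagliardoEnergy α Set.univ f ≤ C * sobolevEnergy α f := by
  obtain ⟨C, hC, hK⟩ := exists_gagliardoSymbol_le hα₀ hα₁
  refine ⟨1 + C, by finiteness, fun f => ?_⟩
  have hc := continuous_fourierT f
  rw [gagliardoEnergy_eq_lintegral_symbol, ← lintegral_enorm_sq_fourierT,
    ← lintegral_add_left (by fun_prop), sobolevEnergy, ← lintegral_const_mul' _ _ (by finiteness)]
  refine lintegral_mono fun ξ => ?_
  have h1 : 1 ≤ ENNReal.ofReal ((1 + ‖ξ‖ ^ 2) ^ α) := by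
    rw [ENNReal.one_le_ofReal]
    exact Real.one_le_rpow (by nlinarith [norm_nonneg ξ]) hα₀.le
  calc _ ≤ ENNReal.ofReal ((1 + ‖ξ‖ ^ 2) ^ α) * ‖fourierT f ξ‖ₑ ^ 2 +
        C * ENNReal.ofReal ((1 + ‖ξ‖ ^ 2) ^ α) * ‖fourierT f ξ‖ₑ ^ 2 := by
        gcongr
        · exact le_mul_of_one_le_left (by positivity) h1
        · exact hK ξ
    _ = _ := by ring

/-! ### Inversion in the unit circle -/

theorem inversion_zero_one_eq_smul (x : EuclideanSpace ℝ (Fin 2)) :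
    inversion 0 1 x = (1 / ‖x‖ ^ 2 : ℝ) • x := by
  simp [inversion]

theorem norm_inversion_zero_one (x : EuclideanSpace ℝ (Fin 2)) :
    ‖inversion 0 1 x‖ = ‖x‖⁻¹ := by
  have := dist_inversion_center (0 : EuclideanSpace ℝ (Fin 2)) x 1
  simpa using this

theorem norm_sub_eq_mul_norm_inversion_sub {x y : EuclideanSpace ℝ (Fin 2)} (hx : x ≠ 0)
    (hy : y ≠ 0) :
    ‖y - x‖ = ‖x‖ * ‖y‖ * ‖inversion 0 1 y - inversion 0 1 x‖ := by
  have := dist_inversion_inversion hy hx 1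
  rw [dist_eq_norm, dist_zero_right, dist_zero_right, dist_eq_norm] at this
  have hx0 := norm_pos_iff.mpr hx
  have hy0 := norm_pos_iff.mpr hy
  rw [this]
  field_simp

theorem inversionWeighted_apply (f : EuclideanSpace ℝ (Fin 2) → ℂ)
    (x : EuclideanSpace ℝ (Fin 2)) :
    inversionWeighted f x = ((‖inversion 0 1 x‖ ^ 4 : ℝ) : ℂ) * f (inversion 0 1 x) := by
  rw [inversionWeighted, norm_inversion_zero_one, inversion_zero_one_eq_smul]
  simp

/-- The absolute Jacobian of the inversion; the left-hand side is the derivative in the form given by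
`EuclideanGeometry.hasFDerivAt_inversion`. -/
theorem abs_det_fderiv_inversion {x : EuclideanSpace ℝ (Fin 2)} :
    |((1 / dist x 0) ^ 2 • ((ℝ ∙ (x - 0))ᗮ.reflection :
      EuclideanSpace ℝ (Fin 2) →L[ℝ] EuclideanSpace ℝ (Fin 2))).det| = (‖x‖ ^ 4)⁻¹ := by
  have h : LinearMap.det ((ℝ ∙ (x - 0))ᗮ.reflection :
      EuclideanSpace ℝ (Fin 2) →ₗ[ℝ] EuclideanSpace ℝ (Fin 2)) = _ :=
    Submodule.det_reflection (ℝ ∙ (x - 0))ᗮ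
  rw [ContinuousLinearMap.det, ContinuousLinearMap.toLinearMap_smul, LinearMap.det_smul]
  erw [h]
  rw [abs_mul, abs_neg_one_pow, mul_one, abs_pow, finrank_euclideanSpace,
    Fintype.card_fin, dist_zero_right, abs_of_nonneg (by positivity)]
  ring

theorem setLIntegral_comp_inversion_le {R : ℝ} {A : Set (EuclideanSpace ℝ (Fin 2))}
    (hA : MeasurableSet A) (hA0 : ∀ x ∈ A, x ≠ 0) (hAR : ∀ x ∈ A, ‖x‖ ≤ R)
    (F : EuclideanSpace ℝ (Fin 2) → ℝ≥0∞) :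
    ∫⁻ x in A, F (inversion 0 1 x) ≤ ENNReal.ofReal (R ^ 4) * ∫⁻ u, F u := by
  have hinj : Set.InjOn (inversion (0 : EuclideanSpace ℝ (Fin 2)) 1) A :=
    (inversion_injective _ one_ne_zero).injOn
  have h := lintegral_image_eq_lintegral_abs_det_fderiv_mul volume hA
    (fun x hx => (hasFDerivAt_inversion (R := 1) (hA0 x hx)).hasFDerivWithinAt) hinj F
  simp_rw [abs_det_fderiv_inversion] at h
  calc ∫⁻ x in A, F (inversion 0 1 x)
      ≤ ∫⁻ x in A, ENNReal.ofReal (R ^ 4) *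
          (ENNReal.ofReal (‖x‖ ^ 4)⁻¹ * F (inversion 0 1 x)) := by
        refine setLIntegral_mono' hA fun x hx => ?_
        rw [← mul_assoc, ← ENNReal.ofReal_mul (by positivity)]
        have hx0 := norm_pos_iff.mpr (hA0 x hx)
        refine le_mul_of_one_le_left (by positivity) ?_
        rw [ENNReal.one_le_ofReal, ← div_eq_mul_inv, one_le_div (by positivity)]
        exact pow_le_pow_left₀ hx0.le (hAR x hx) 4
    _ = ENNReal.ofReal (R ^ 4) * ∫⁻ u in inversion 0 1 '' A, F u := by
        rw [lintegral_const_mul' _ _ (by finiteness), h]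
    _ ≤ _ := by
        gcongr
        exact Measure.restrict_le_self

/-- The closed annulus `a ≤ |x| ≤ b` in the plane. -/
def closedAnnulus (a b : ℝ) : Set (EuclideanSpace ℝ (Fin 2)) := {x | a ≤ ‖x‖ ∧ ‖x‖ ≤ b}

theorem isClosed_closedAnnulus (a b : ℝ) : IsClosed (closedAnnulus a b) :=
  (isClosed_le continuous_const continuous_norm).inter
    (isClosed_le continuous_norm continuous_const)

theorem hasCompactSupport_of_support_subset_closedAnnulus {a b : ℝ}
    {f : EuclideanSpace ℝ (Fin 2) → ℂ} (hf : Function.support f ⊆ closedAnnulus a b) :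
    HasCompactSupport f :=
  HasCompactSupport.intro (isCompact_closedBall (0 : EuclideanSpace ℝ (Fin 2)) b) fun x hx => by
    by_contra h
    exact hx (mem_closedBall_zero_iff.mpr (hf h).2)

theorem inversionWeighted_inversionWeighted {f : EuclideanSpace ℝ (Fin 2) → ℂ} (hf : f 0 = 0) :
    inversionWeighted (inversionWeighted f) = f := by
  ext x
  rcases eq_or_ne x 0 with rfl | hx
  · rw [hf]
    simp [inversionWeighted]
  have hx0 : (‖x‖ : ℂ) ≠ 0 := by exact_mod_cast (norm_pos_iff.mpr hx).ne'
  rw [inversionWeighted_apply, inversionWeighted_apply, inversion_inversion _ one_ne_zero,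
    norm_inversion_zero_one]
  push_cast
  field_simp

theorem support_inversionWeighted_subset {a b : ℝ} (ha : 0 < a)
    {f : EuclideanSpace ℝ (Fin 2) → ℂ} (hf : Function.support f ⊆ closedAnnulus a b) :
    Function.support (inversionWeighted f) ⊆ closedAnnulus b⁻¹ a⁻¹ := by
  intro x hx
  rw [Function.mem_support, inversionWeighted_apply] at hx
  obtain ⟨h1, h2⟩ := hf (right_ne_zero_of_mul hx)
  rw [norm_inversion_zero_one] at h1 h2
  have hx0 : 0 < ‖x‖ := inv_pos.mp (ha.trans_le h1)
  exact ⟨inv_le_of_inv_le₀ hx0 h2, (le_inv_comm₀ ha hx0).mp h1⟩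

theorem contDiff_inversionWeighted {a b : ℝ} (ha : 0 < a) (hb : 0 < b)
    {f : EuclideanSpace ℝ (Fin 2) → ℂ} (hf : Function.support f ⊆ closedAnnulus a b)
    (hfs : ContDiff ℝ ∞ f) : ContDiff ℝ ∞ (inversionWeighted f) := by
  rw [contDiff_iff_contDiffAt]
  intro x
  rcases eq_or_ne x 0 with rfl | hx
  · -- the function vanishes near the origin, because `f` vanishes near infinity
    refine (contDiffAt_const (c := (0 : ℂ))).congr_of_eventuallyEq ?_
    filter_upwards [Metric.ball_mem_nhds (0 : EuclideanSpace ℝ (Fin 2)) (inv_pos.mpr hb)] with y hy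
    by_contra h
    have := (support_inversionWeighted_subset ha hf h).1
    rw [mem_ball_zero_iff] at hy
    linarith
  · have hx0 : ‖x‖ ≠ 0 := norm_ne_zero_iff.mpr hx
    have hn : ContDiffAt ℝ ∞ (fun y : EuclideanSpace ℝ (Fin 2) => ‖y‖) x := contDiffAt_norm ℝ hx
    have h4 : ContDiffAt ℝ ∞ (fun y : EuclideanSpace ℝ (Fin 2) => (1 / ‖y‖ ^ 4 : ℝ)) x :=
      contDiffAt_const.div (hn.pow 4) (by positivity)
    have h2 : ContDiffAt ℝ ∞ (fun y : EuclideanSpace ℝ (Fin 2) => (1 / ‖y‖ ^ 2 : ℝ)) x :=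
      contDiffAt_const.div (hn.pow 2) (by positivity)
    exact (Complex.ofRealCLM.contDiff.contDiffAt.comp x h4).mul
      (hfs.contDiffAt.comp x (h2.smul contDiffAt_id))

/-! ### The inversion is bounded for the Gagliardo seminorm on annuli -/

theorem gagliardoEnergy_eq_lintegral_lintegral {n : ℕ} (α : ℝ)
    {S : Set (EuclideanSpace ℝ (Fin n))} (hS : MeasurableSet S)
    {f : EuclideanSpace ℝ (Fin n) → ℂ} (hf : Measurable f) :
    gagliardoEnergy α S f =
      ∫⁻ x, ∫⁻ y, S.indicator (gagliardoKernel n α) (y - x) * ‖f y - f x‖ₑ ^ 2 := by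
  have hm : Measurable (S.indicator (gagliardoKernel n α)) :=
    (measurable_gagliardoKernel n α).indicator hS
  calc gagliardoEnergy α S f
      = ∫⁻ h, ∫⁻ x, S.indicator (gagliardoKernel n α) h * ‖f (x + h) - f x‖ₑ ^ 2 := by
        rw [gagliardoEnergy, ← lintegral_indicator hS]
        refine lintegral_congr fun h => ?_
        rw [lintegral_const_mul _ (by fun_prop)]
        by_cases hh : h ∈ S <;> simp [hh]
    _ = ∫⁻ x, ∫⁻ h, S.indicator (gagliardoKernel n α) h * ‖f (x + h) - f x‖ₑ ^ 2 :=
        lintegral_lintegral_swap (by fun_prop)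
    _ = _ := by
        refine lintegral_congr fun x => ?_
        rw [← lintegral_sub_right_eq_self _ x]
        simp

theorem abs_pow_four_sub_le {M s t : ℝ} (hs : 0 ≤ s) (ht : 0 ≤ t) (hsM : s ≤ M) (htM : t ≤ M) :
    |t ^ 4 - s ^ 4| ≤ 4 * M ^ 3 * |t - s| := by
  have h : t ^ 4 - s ^ 4 = (t ^ 3 + t ^ 2 * s + t * s ^ 2 + s ^ 3) * (t - s) := by ring
  have hM : 0 ≤ M := hs.trans hsM
  rw [h, abs_mul, abs_of_nonneg (by positivity)]
  refine mul_le_mul_of_nonneg_right ?_ (abs_nonneg _)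
  calc t ^ 3 + t ^ 2 * s + t * s ^ 2 + s ^ 3
      ≤ M ^ 3 + M ^ 2 * M + M * M ^ 2 + M ^ 3 := by gcongr
    _ = _ := by ring

/-- The pointwise comparison of the Gagliardo integrands of `inversionWeighted f` and `f`. The
second term on the right comes from the variation of the weight `|x|⁻⁴`; its kernel
`|h|^(2-(2+2α))` is locally integrable. -/
theorem gagliardo_integrand_inversionWeighted_le (α : ℝ) (hα₀ : 0 < α) {m : ℝ} (hm : 0 < m)
    (f : EuclideanSpace ℝ (Fin 2) → ℂ) {x y : EuclideanSpace ℝ (Fin 2)} (hx : m ≤ ‖x‖)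
    (hy : m ≤ ‖y‖) :
    gagliardoKernel 2 α (y - x) * ‖inversionWeighted f y - inversionWeighted f x‖ₑ ^ 2 ≤
      ENNReal.ofReal ((m ^ 2) ^ (-(((2 : ℕ) : ℝ) + 2 * α)) * (2 * m⁻¹ ^ 8 + 32 * m⁻¹ ^ 6)) *
      (gagliardoKernel 2 α (inversion 0 1 y - inversion 0 1 x) *
          ‖f (inversion 0 1 y) - f (inversion 0 1 x)‖ₑ ^ 2 +
        ENNReal.ofReal (‖inversion 0 1 y - inversion 0 1 x‖ ^ 2) *
          gagliardoKernel 2 α (inversion 0 1 y - inversion 0 1 x) *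
          ‖f (inversion 0 1 x)‖ₑ ^ 2) := by
  have hx0 : 0 < ‖x‖ := hm.trans_le hx
  have hy0 : 0 < ‖y‖ := hm.trans_le hy
  set M := m⁻¹ with hM
  have hM0 : 0 < M := inv_pos.mpr hm
  have hd := norm_sub_eq_mul_norm_inversion_sub (norm_pos_iff.mp hx0) (norm_pos_iff.mp hy0)
  have hu : ‖inversion 0 1 x‖ ≤ M := by
    rw [norm_inversion_zero_one]; exact inv_anti₀ hm hx
  have hv : ‖inversion 0 1 y‖ ≤ M := by
    rw [norm_inversion_zero_one]; exact inv_anti₀ hm hy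
  rw [inversionWeighted_apply, inversionWeighted_apply]
  set u := inversion 0 1 x
  set v := inversion 0 1 y
  set s : ℝ := ((2 : ℕ) : ℝ) + 2 * α with hs
  have hk : ‖y - x‖ ^ (-s) ≤ (m ^ 2) ^ (-s) * ‖v - u‖ ^ (-s) := by
    rw [hd, Real.mul_rpow (by positivity) (norm_nonneg _)]
    refine mul_le_mul_of_nonneg_right ?_ (by positivity)
    refine Real.rpow_le_rpow_of_nonpos (by positivity) ?_ (by rw [hs]; push_cast; linarith)
    rw [sq]
    gcongr
  have hg : ‖((‖v‖ ^ 4 : ℝ) : ℂ) * f v - ((‖u‖ ^ 4 : ℝ) : ℂ) * f u‖ ≤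
      M ^ 4 * ‖f v - f u‖ + 4 * M ^ 3 * ‖v - u‖ * ‖f u‖ := by
    have : ((‖v‖ ^ 4 : ℝ) : ℂ) * f v - ((‖u‖ ^ 4 : ℝ) : ℂ) * f u =
        ((‖v‖ ^ 4 : ℝ) : ℂ) * (f v - f u) + ((‖v‖ ^ 4 - ‖u‖ ^ 4 : ℝ) : ℂ) * f u := by
      push_cast; ring
    rw [this]
    refine (norm_add_le _ _).trans ?_
    rw [norm_mul, norm_mul, Complex.norm_real, Complex.norm_real, Real.norm_of_nonneg (by positivity),
      Real.norm_eq_abs]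
    gcongr
    refine (abs_pow_four_sub_le (norm_nonneg u) (norm_nonneg v) hu hv).trans ?_
    gcongr
    exact abs_norm_sub_norm_le v u
  have hg2 : ‖((‖v‖ ^ 4 : ℝ) : ℂ) * f v - ((‖u‖ ^ 4 : ℝ) : ℂ) * f u‖ ^ 2 ≤
      (2 * M ^ 8 + 32 * M ^ 6) * (‖f v - f u‖ ^ 2 + ‖v - u‖ ^ 2 * ‖f u‖ ^ 2) := by
    calc _ ≤ (M ^ 4 * ‖f v - f u‖ + 4 * M ^ 3 * ‖v - u‖ * ‖f u‖) ^ 2 :=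
          pow_le_pow_left₀ (norm_nonneg _) hg 2
      _ ≤ 2 * ((M ^ 4 * ‖f v - f u‖) ^ 2 + (4 * M ^ 3 * ‖v - u‖ * ‖f u‖) ^ 2) := add_sq_le
      _ = 2 * M ^ 8 * ‖f v - f u‖ ^ 2 + 32 * M ^ 6 * (‖v - u‖ ^ 2 * ‖f u‖ ^ 2) := by ring
      _ ≤ (2 * M ^ 8 + 32 * M ^ 6) * ‖f v - f u‖ ^ 2 +
          (2 * M ^ 8 + 32 * M ^ 6) * (‖v - u‖ ^ 2 * ‖f u‖ ^ 2) := by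
          gcongr
          · exact le_add_of_nonneg_right (by positivity)
          · exact le_add_of_nonneg_left (by positivity)
      _ = _ := by ring
  unfold gagliardoKernel
  simp only [← ofReal_norm, ← hs]
  rw [← ENNReal.ofReal_pow (norm_nonneg _), ← ENNReal.ofReal_pow (norm_nonneg _),
    ← ENNReal.ofReal_pow (norm_nonneg _), ← ENNReal.ofReal_mul (by positivity),
    ← ENNReal.ofReal_mul (by positivity), ← ENNReal.ofReal_mul (by positivity),
    ← ENNReal.ofReal_mul (by positivity), ← ENNReal.ofReal_add (by positivity) (by positivity),
    ← ENNReal.ofReal_mul (by positivity)]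
  refine ENNReal.ofReal_le_ofReal ?_
  calc _ ≤ ((m ^ 2) ^ (-s) * ‖v - u‖ ^ (-s)) *
        ((2 * M ^ 8 + 32 * M ^ 6) * (‖f v - f u‖ ^ 2 + ‖v - u‖ ^ 2 * ‖f u‖ ^ 2)) := by
        gcongr
    _ = _ := by ring

theorem lintegral_enorm_sq_inversionWeighted_le {a b : ℝ} (ha : 0 < a) (hb : 0 < b)
    {f : EuclideanSpace ℝ (Fin 2) → ℂ} (hf : Function.support f ⊆ closedAnnulus a b) :
    ∫⁻ x, ‖inversionWeighted f x‖ₑ ^ 2 ≤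
      ENNReal.ofReal ((b ^ 4) ^ 2) * ENNReal.ofReal (a⁻¹ ^ 4) * ∫⁻ x, ‖f x‖ₑ ^ 2 := by
  have hA := (isClosed_closedAnnulus b⁻¹ a⁻¹).measurableSet
  have hpt (x : EuclideanSpace ℝ (Fin 2)) : ‖inversionWeighted f x‖ₑ ^ 2 ≤
      (closedAnnulus b⁻¹ a⁻¹).indicator
        (fun x => ENNReal.ofReal ((b ^ 4) ^ 2) * ‖f (inversion 0 1 x)‖ₑ ^ 2) x := by
    by_cases hx : x ∈ closedAnnulus b⁻¹ a⁻¹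
    · rw [Set.indicator_of_mem hx, inversionWeighted_apply, enorm_mul, mul_pow]
      gcongr
      rw [← ofReal_norm, ← ENNReal.ofReal_pow (norm_nonneg _), Complex.norm_real,
        Real.norm_of_nonneg (by positivity), norm_inversion_zero_one]
      refine ENNReal.ofReal_le_ofReal ?_
      gcongr
      exact inv_le_of_inv_le₀ hb hx.1
    · have : inversionWeighted f x = 0 := by
        by_contra h
        exact hx (support_inversionWeighted_subset ha hf h)
      simp [this]
  refine (lintegral_mono hpt).trans ?_
  rw [lintegral_indicator hA, lintegral_const_mul' _ _ (by finiteness), mul_assoc]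
  gcongr
  refine setLIntegral_comp_inversion_le hA (fun x hx => ?_) (fun x hx => hx.2)
    (fun u => ‖f u‖ₑ ^ 2)
  exact norm_pos_iff.mp ((inv_pos.mpr hb).trans_le hx.1)

/-- For steps `h` shorter than half the inner radius of the support, both `x` and `x + h` stay in
a fixed annulus away from the origin, so the Gagliardo integral can be transported by the
inversion, whose Jacobian is bounded there. -/
theorem exists_gagliardoEnergy_inversionWeighted_le {α : ℝ} (hα₀ : 0 < α) (hα₁ : α < 1) {a b : ℝ}
    (ha : 0 < a) (hb : 0 < b) :
    ∃ C : ℝ≥0∞, C ≠ ⊤ ∧ ∀ f : EuclideanSpace ℝ (Fin 2) → ℂ,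
      Function.support f ⊆ closedAnnulus a b → ContDiff ℝ ∞ f →
      gagliardoEnergy α (Metric.ball 0 (b⁻¹ / 2)) (inversionWeighted f) ≤
        C * ((∫⁻ x, ‖f x‖ₑ ^ 2) + gagliardoEnergy α Set.univ f) := by
  set m : ℝ := b⁻¹ / 2 with hm
  have hm0 : 0 < m := by positivity
  set R : ℝ := a⁻¹ + m with hR
  set B : Set (EuclideanSpace ℝ (Fin 2)) := Metric.ball 0 (2 * m⁻¹ + 1) with hBdef
  have hB : MeasurableSet B := Metric.isOpen_ball.measurableSet
  set φ : EuclideanSpace ℝ (Fin 2) → ℝ≥0∞ :=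
    fun h => ENNReal.ofReal (‖h‖ ^ 2) * gagliardoKernel 2 α h with hφ
  have hφm : Measurable (B.indicator φ) := by
    refine Measurable.indicator ?_ hB
    fun_prop
  set κ : ℝ≥0∞ := ∫⁻ h, B.indicator φ h with hκ
  have hκt : κ ≠ ⊤ := by
    rw [hκ, lintegral_indicator hB]
    exact (setLIntegral_ball_norm_sq_mul_gagliardoKernel_lt_top hα₁ _).ne
  set K : ℝ≥0∞ := ENNReal.ofReal
    ((m ^ 2) ^ (-(((2 : ℕ) : ℝ) + 2 * α)) * (2 * m⁻¹ ^ 8 + 32 * m⁻¹ ^ 6)) with hK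
  have hKt : K ≠ ⊤ := ENNReal.ofReal_ne_top
  set A : Set (EuclideanSpace ℝ (Fin 2)) := closedAnnulus m R with hAdef
  have hA : MeasurableSet A := (isClosed_closedAnnulus m R).measurableSet
  have hA0 : ∀ x ∈ A, x ≠ 0 := fun x hx => norm_pos_iff.mp (hm0.trans_le hx.1)
  have hAR : ∀ x ∈ A, ‖x‖ ≤ R := fun x hx => hx.2
  refine ⟨K * ENNReal.ofReal (R ^ 4) * ENNReal.ofReal (R ^ 4) * (1 + κ), by finiteness,
    fun f hf hfs => ?_⟩
  have hfc := hfs.continuous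
  have hgm : Measurable (inversionWeighted f) :=
    (contDiff_inversionWeighted ha hb hf hfs).continuous.measurable
  set F : EuclideanSpace ℝ (Fin 2) → EuclideanSpace ℝ (Fin 2) → ℝ≥0∞ := fun u v =>
    gagliardoKernel 2 α (v - u) * ‖f v - f u‖ₑ ^ 2 + B.indicator φ (v - u) * ‖f u‖ₑ ^ 2 with hF
  -- if one of two points at distance less than `m` lies in the support, both lie in `A`
  have hnear {x y : EuclideanSpace ℝ (Fin 2)} (hxy : ‖y - x‖ < m)
      (hx : inversionWeighted f x ≠ 0) : x ∈ A ∧ y ∈ A := by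
    obtain ⟨h1, h2⟩ := support_inversionWeighted_subset ha hf hx
    have h3 : b⁻¹ = 2 * m := by rw [hm]; ring
    have h4 := abs_le.mp (abs_norm_sub_norm_le y x)
    refine ⟨⟨by linarith, by linarith⟩, ⟨by linarith, by linarith⟩⟩
  have hpt (x y : EuclideanSpace ℝ (Fin 2)) :
      (Metric.ball 0 m).indicator (gagliardoKernel 2 α) (y - x) *
        ‖inversionWeighted f y - inversionWeighted f x‖ₑ ^ 2 ≤
      A.indicator (fun x => A.indicator
        (fun y => K * F (inversion 0 1 x) (inversion 0 1 y)) y) x := by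
    by_cases hxy : ‖y - x‖ < m
    swap
    · rw [Set.indicator_of_notMem (by simpa using hxy), zero_mul]
      exact zero_le
    by_cases h : x ∈ A ∧ y ∈ A
    · obtain ⟨hx, hy⟩ := h
      rw [Set.indicator_of_mem hx, Set.indicator_of_mem hy,
        Set.indicator_of_mem (by simpa using hxy)]
      have hmem : inversion 0 1 y - inversion 0 1 x ∈ B := by
        rw [hBdef, mem_ball_zero_iff]
        refine (norm_sub_le _ _).trans_lt ?_
        rw [norm_inversion_zero_one, norm_inversion_zero_one]
        linarith [inv_anti₀ hm0 hx.1, inv_anti₀ hm0 hy.1]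
      simp only [hF]
      rw [Set.indicator_of_mem hmem]
      exact gagliardo_integrand_inversionWeighted_le α hα₀ hm0 f hx.1 hy.1
    · have h1 : inversionWeighted f x = 0 := by
        by_contra h1
        exact h (hnear hxy h1)
      have h2 : inversionWeighted f y = 0 := by
        by_contra h2
        exact h (hnear (by rwa [norm_sub_rev]) h2).symm
      simp [h1, h2]
  calc gagliardoEnergy α (Metric.ball 0 m) (inversionWeighted f)
      = ∫⁻ x, ∫⁻ y, (Metric.ball 0 m).indicator (gagliardoKernel 2 α) (y - x) *
          ‖inversionWeighted f y - inversionWeighted f x‖ₑ ^ 2 :=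
        gagliardoEnergy_eq_lintegral_lintegral α Metric.isOpen_ball.measurableSet hgm
    _ ≤ ∫⁻ x, ∫⁻ y, A.indicator (fun x => A.indicator
          (fun y => K * F (inversion 0 1 x) (inversion 0 1 y)) y) x :=
        lintegral_mono fun x => lintegral_mono fun y => hpt x y
    _ = ∫⁻ x in A, K * ∫⁻ y in A, F (inversion 0 1 x) (inversion 0 1 y) := by
        rw [← lintegral_indicator hA]
        refine lintegral_congr fun x => ?_
        by_cases hx : x ∈ A
        · simp only [Set.indicator_of_mem hx]
          rw [lintegral_indicator hA, lintegral_const_mul' _ _ hKt]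
        · simp [hx]
    _ ≤ ∫⁻ x in A, K * (ENNReal.ofReal (R ^ 4) * ∫⁻ v, F (inversion 0 1 x) v) := by
        refine lintegral_mono fun x => ?_
        dsimp only
        gcongr
        exact setLIntegral_comp_inversion_le hA hA0 hAR (F (inversion 0 1 x))
    _ ≤ K * (ENNReal.ofReal (R ^ 4) * (ENNReal.ofReal (R ^ 4) * ∫⁻ u, ∫⁻ v, F u v)) := by
        rw [lintegral_const_mul' _ _ hKt, lintegral_const_mul' _ _ (by finiteness)]
        gcongr
        exact setLIntegral_comp_inversion_le hA hA0 hAR (fun u => ∫⁻ v, F u v)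
    _ = K * (ENNReal.ofReal (R ^ 4) * (ENNReal.ofReal (R ^ 4) *
          (gagliardoEnergy α Set.univ f + κ * ∫⁻ x, ‖f x‖ₑ ^ 2))) := by
        congr 3
        rw [gagliardoEnergy_eq_lintegral_lintegral α MeasurableSet.univ hfc.measurable,
          ← lintegral_const_mul' _ _ hκt]
        simp only [Set.indicator_univ]
        rw [← lintegral_add_left (Measurable.lintegral_prod_right' (f := fun p : _ × _ =>
          gagliardoKernel 2 α (p.2 - p.1) * ‖f p.2 - f p.1‖ₑ ^ 2) (by fun_prop))]
        refine lintegral_congr fun u => ?_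
        simp only [hF]
        rw [lintegral_add_left (by fun_prop), lintegral_mul_const _ (by fun_prop),
          lintegral_sub_right_eq_self (B.indicator φ) u]
    _ ≤ _ := by
        rw [mul_assoc, mul_assoc, mul_assoc]
        gcongr
        rw [add_mul, one_mul, add_comm (gagliardoEnergy α Set.univ f)]
        rw [mul_add]
        calc κ * (∫⁻ x, ‖f x‖ₑ ^ 2) + gagliardoEnergy α Set.univ f
            ≤ ((∫⁻ x, ‖f x‖ₑ ^ 2) + gagliardoEnergy α Set.univ f) +
              (κ * (∫⁻ x, ‖f x‖ₑ ^ 2)) := by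
              rw [add_comm]
              gcongr
              exact le_add_self
          _ ≤ _ := by
              gcongr
              exact le_self_add

/-- One half of the norm equivalence; the other half is the same statement for
`inversionWeighted f`, because the transformation is an involution. -/
theorem exists_sobolevEnergy_inversionWeighted_le {α : ℝ} (hα₀ : 0 < α) (hα₁ : α < 1) {a b : ℝ}
    (ha : 0 < a) (hb : 0 < b) :
    ∃ C : ℝ≥0∞, C ≠ ⊤ ∧ ∀ f : EuclideanSpace ℝ (Fin 2) → ℂ,
      Function.support f ⊆ closedAnnulus a b → ContDiff ℝ ∞ f →
      sobolevEnergy α (inversionWeighted f) ≤ C * sobolevEnergy α f := by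
  obtain ⟨C₁, hC₁, h₁⟩ := exists_sobolevEnergy_le hα₀ (δ := b⁻¹ / 2) (by positivity)
  obtain ⟨C₂, hC₂, h₂⟩ := exists_gagliardoEnergy_inversionWeighted_le hα₀ hα₁ ha hb
  obtain ⟨C₃, hC₃, h₃⟩ := exists_le_sobolevEnergy hα₀ hα₁
  set L : ℝ≥0∞ := ENNReal.ofReal ((b ^ 4) ^ 2) * ENNReal.ofReal (a⁻¹ ^ 4) with hL
  refine ⟨C₁ * ((L + C₂) * C₃), by finiteness, fun f hf hfs => ?_⟩
  have hgs := contDiff_inversionWeighted ha hb hf hfs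
  have hg := hasCompactSupport_of_support_subset_closedAnnulus
    (support_inversionWeighted_subset ha hf)
  have hfc := hasCompactSupport_of_support_subset_closedAnnulus hf
  calc sobolevEnergy α (inversionWeighted f)
      ≤ C₁ * ((∫⁻ x, ‖inversionWeighted f x‖ₑ ^ 2) +
          gagliardoEnergy α (Metric.ball 0 (b⁻¹ / 2)) (inversionWeighted f)) :=
        h₁ (hg.toSchwartzMap hgs)
    _ ≤ C₁ * (L * ((∫⁻ x, ‖f x‖ₑ ^ 2) + gagliardoEnergy α Set.univ f) +
          C₂ * ((∫⁻ x, ‖f x‖ₑ ^ 2) + gagliardoEnergy α Set.univ f)) := by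
        gcongr
        · refine (lintegral_enorm_sq_inversionWeighted_le ha hb hf).trans ?_
          gcongr
          exact le_self_add
        · exact h₂ f hf hfs
    _ = C₁ * ((L + C₂) * ((∫⁻ x, ‖f x‖ₑ ^ 2) + gagliardoEnergy α Set.univ f)) := by
        rw [add_mul]
    _ ≤ C₁ * ((L + C₂) * (C₃ * sobolevEnergy α f)) := by
        gcongr
        exact h₃ (hfc.toSchwartzMap hfs)
    _ = _ := by ring

theorem exists_normH_inversionWeighted_le {α : ℝ} (hα₀ : 0 < α) (hα₁ : α < 1) {a b : ℝ}
    (ha : 0 < a) (hb : 0 < b) :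
    ∃ C : ℝ, 0 < C ∧ ∀ f : EuclideanSpace ℝ (Fin 2) → ℂ,
      Function.support f ⊆ closedAnnulus a b → ContDiff ℝ ∞ f →
      normH α (inversionWeighted f) ≤ C * normH α f := by
  obtain ⟨C, hC, h⟩ := exists_sobolevEnergy_inversionWeighted_le hα₀ hα₁ ha hb
  refine ⟨√(C.toReal + 1), by positivity, fun f hf hfs => ?_⟩
  have hgs := contDiff_inversionWeighted ha hb hf hfs
  have hg := hasCompactSupport_of_support_subset_closedAnnulus
    (support_inversionWeighted_subset ha hf)
  have hfc := hasCompactSupport_of_support_subset_closedAnnulus hf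
  have hfin : sobolevEnergy α f ≠ ⊤ := sobolevEnergy_ne_top α (hfc.toSchwartzMap hfs)
  have h1 : normH α (inversionWeighted f) = √(sobolevEnergy α (inversionWeighted f)).toReal :=
    normH_eq_sqrt_sobolevEnergy α (hg.toSchwartzMap hgs)
  have h2 : normH α f = √(sobolevEnergy α f).toReal :=
    normH_eq_sqrt_sobolevEnergy α (hfc.toSchwartzMap hfs)
  rw [h1, h2, ← Real.sqrt_mul (by positivity)]
  refine Real.sqrt_le_sqrt ?_
  have h3 := ENNReal.toReal_mono (by finiteness) (h f hf hfs)
  rw [ENNReal.toReal_mul] at h3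
  nlinarith [ENNReal.toReal_nonneg (a := sobolevEnergy α f)]

/-! ### The disc -/

theorem detectorDisc_subset_closedAnnulus {r : ℝ} (hr : 1 < r) :
    detectorDisc r ⊆ closedAnnulus 1 r := by
  intro x hx
  have hx' : x 0 ^ 2 + (x 1 - (r + 1) / 2) ^ 2 < (r - 1) ^ 2 / 4 := hx
  have hn : ‖x‖ ^ 2 = x 0 ^ 2 + x 1 ^ 2 := by
    rw [EuclideanSpace.real_norm_sq_eq, Fin.sum_univ_two]
  have h1 : 1 ≤ x 1 := by nlinarith [sq_nonneg (x 0)]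
  have h2 : x 1 ≤ r := by nlinarith [sq_nonneg (x 0)]
  constructor
  · refine (one_le_sq_iff₀ (norm_nonneg x)).mp ?_
    rw [hn]
    nlinarith [sq_nonneg (x 0)]
  · refine (sq_le_sq₀ (norm_nonneg x) (by linarith)).mp ?_
    rw [hn]
    nlinarith

end DiscTransform

theorem mainTheorem5 (r : ℝ) (hr : 1 < r) (α : ℝ) (hα₀ : 0 < α) (hα₁ : α < 1) :
    ∃ c C : ℝ, 0 < c ∧ 0 < C ∧
      ∀ f : EuclideanSpace ℝ (Fin 2) → ℂ,
        DiscTransform.IsTestFunction (DiscTransform.detectorDisc r) f →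
          DiscTransform.MemH α f ∧
          DiscTransform.MemH α (DiscTransform.inversionWeighted f) ∧
          c * DiscTransform.normH α (DiscTransform.inversionWeighted f)
            ≤ DiscTransform.normH α f ∧
          DiscTransform.normH α f
            ≤ C * DiscTransform.normH α (DiscTransform.inversionWeighted f) := by
  have hr0 : 0 < r := by linarith
  obtain ⟨C₁, hC₁, h₁⟩ :=
    DiscTransform.exists_normH_inversionWeighted_le hα₀ hα₁ one_pos hr0
  obtain ⟨C₂, hC₂, h₂⟩ :=
    DiscTransform.exists_normH_inversionWeighted_le hα₀ hα₁ (inv_pos.mpr hr0)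
      (inv_pos.mpr one_pos)
  refine ⟨C₁⁻¹, C₂, inv_pos.mpr hC₁, hC₂, fun f hf => ?_⟩
  obtain ⟨hfs, hfc, hft⟩ := hf
  have hsupp : Function.support f ⊆ DiscTransform.closedAnnulus 1 r :=
    (subset_tsupport f).trans (hft.trans (DiscTransform.detectorDisc_subset_closedAnnulus hr))
  have hgs := DiscTransform.contDiff_inversionWeighted one_pos hr0 hsupp hfs
  have hgsupp := DiscTransform.support_inversionWeighted_subset one_pos hsupp
  have hgc := DiscTransform.hasCompactSupport_of_support_subset_closedAnnulus hgsupp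
  refine ⟨DiscTransform.memH_of_schwartz α (hfc.toSchwartzMap hfs),
    DiscTransform.memH_of_schwartz α (hgc.toSchwartzMap hgs), ?_, ?_⟩
  · rw [inv_mul_le_iff₀ hC₁]
    exact h₁ f hsupp hfs
  · have hf0 : f 0 = 0 := by
      by_contra h
      have := (hsupp h).1
      rw [norm_zero] at this
      linarith
    have h := h₂ _ hgsupp hgs
    rwa [DiscTransform.inversionWeighted_inversionWeighted hf0] at h
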